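/- Let $N$ be an odd positive integer, $p$ a prime, $j$ the smallest positive integer with $N \mid p^j+1$ (it is assumed to exist), $s \ge 2$, and let $q, m$ be such that $q^m = p^{2js}$. Assume $\gcd\left(N, \frac{q^m-1}{N}\right)=1$. For a finite additively written abelian group $G$ and a subset $D \subseteq G$ with $0\notin D$ and $-D=D$, let $\mathrm{Cay}(G,D)$ be the graph with vertex set $G$ in which two vertices are adjacent if and only if their difference lies in $D$. A strongly regular graph with parameters $(v,k,\lambda,\mu)$ is a $k$-regular graph on $v$ vertices, neither complete nor edgeless, in which any two adjacent vertices have exactly $\lambda$ common neighbours and any two distinct non-adjacent vertices have exactly $\mu$ common neighbours. 1. If $p$ is odd, then $r=\frac{q^m-1}{2N}$ is an integer, and there exists a strongly regular Cayley graph over the additive group $\mathbb{F}_{q^m}\times\mathbb{F}_{q^m}$ with parameters $\left(q^{2m},\ r(q^m-1),\ q^m+r^2-3r,\ r^2-r\right)$. 2. If $N\ge 2$, then $r=\frac{(N-1)(q^m-1)}{2N}$ is an integer, and there exists a strongly regular Cayley graph over the additive group $\mathbb{F}_{q^m}\times\mathbb{F}_{q^m}$ with parameters $\left(q^{2m},\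 r(q^m-1),\ q^m+r^2-3r,\ r^2-r\right)$. -/

import Mathlib

open Classical in
/-- `D` is the connection set of a Cayley graph over the finite additively written abelian group `G`
(that is, `0 ∉ D` and `-D = D`), and this graph, in which `x ≠ y` are adjacent iff their
difference lies in `D`, is strongly regular with parameters `(v, k, ℓ, μ)`.
As usual, the edgeless and the complete graph are not counted as strongly regular. -/
structure IsStronglyRegularCayley {G : Type*} [AddCommGroup G] [Fintype G]
    (D : Set G) (v k ℓ μ : ℕ) : Prop where
  zero_notMem : (0 : G) ∉ D
  neg_mem_iff : ∀ d : G, -d ∈ D ↔ d ∈ D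
  ne_bot : SimpleGraph.addCayley D ≠ ⊥
  ne_top : SimpleGraph.addCayley D ≠ ⊤
  isSRGWith : (SimpleGraph.addCayley D).IsSRGWith v k ℓ μ

/-!
The parameters `(n², r (n - 1), n + r² - 3 r, r² - r)` with `n = |F|` are of Latin square type, and
a union of any `r` lines through the origin of the affine plane `F × F`, with the origin removed, is
a connection set with these parameters: its graph joins two points of the plane whenever the line
through them has one of `r` prescribed slopes (`isStronglyRegularCayley_lines`).

The graph is regular because the `r` lines meet only in the origin. For the common neighbours of two
points with difference `d ≠ 0`, one counts the `z` for which both `z` and `z - d` have prescribed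
slopes. Two different slopes `s ≠ t` determine a unique `z`, the intersection of the line of slope
`s` through `0` and the line of slope `t` through `d`; it is different from `0` and `d` as long as
neither `s` nor `t` is the slope of `d`. Equal slopes occur only if `d` itself has that slope, and
then all `n - 2` points other than `0` and `d` on the line through `0` and `d` contribute. So there
are `r (r - 1)` common neighbours if `d` lies on no chosen line and `(r - 1) (r - 2) + (n - 2)` if
it lies on one.

What remains is arithmetic: `2 N` divides `qᵐ - 1` if `p` is odd, because `N` is odd and divides
`pʲ + 1`, hence `p²ʲ - 1`, hence `p²ʲˢ - 1`; and in both parts `0 < r < n`.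
-/

/-! ### Unions of lines through the origin of an affine plane -/

/-- The points of `F × F` other than the origin on the lines through the origin whose slope belongs
to `T`. The vertical line is never included. -/
def lineUnion {F : Type*} [Field F] (T : Finset F) : Set (F × F) :=
  {z | z.1 ≠ 0 ∧ ∃ t ∈ T, z.2 = t * z.1}

section LineUnion

variable {F : Type*} [Field F]

theorem zero_notMem_lineUnion (T : Finset F) : (0 : F × F) ∉ lineUnion T := fun h => h.1 rfl

theorem neg_mem_lineUnion_iff (T : Finset F) (d : F × F) : -d ∈ lineUnion T ↔ d ∈ lineUnion T := by
  simp [lineUnion]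

theorem addCayley_lineUnion_adj (T : Finset F) (u v : F × F) :
    (SimpleGraph.addCayley (lineUnion T)).Adj u v ↔ v - u ∈ lineUnion T := by
  rw [SimpleGraph.addCayley_adj, ← neg_mem_lineUnion_iff T (-v + u), neg_add_rev, neg_neg,
    ← sub_eq_neg_add, or_self, and_iff_right_iff_imp]
  rintro h rfl
  exact zero_notMem_lineUnion T (by simpa using h)

theorem ncard_lineUnion [Fintype F] (T : Finset F) :
    (lineUnion T).ncard = T.card * (Fintype.card F - 1) := by
  classical
  have h : lineUnion T =
      ((T ×ˢ Finset.univ.erase (0 : F)).image fun a => (a.2, a.1 * a.2) : Finset (F × F)) := by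
    ext ⟨x, y⟩
    simp only [lineUnion, Set.mem_ofPred_eq, Finset.coe_image, Set.mem_image, Finset.mem_coe,
      Finset.mem_product, Finset.mem_erase, Finset.mem_univ, and_true, Prod.exists, Prod.mk.injEq]
    constructor
    · rintro ⟨hx, t, ht, rfl⟩
      exact ⟨t, x, ⟨ht, hx⟩, rfl, rfl⟩
    · rintro ⟨t, x, ⟨ht, hx⟩, rfl, rfl⟩
      exact ⟨hx, t, ht, rfl⟩
  rw [h, Set.ncard_coe_finset, Finset.card_image_of_injOn, Finset.card_product,
    Finset.card_erase_of_mem (Finset.mem_univ _), Finset.card_univ]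
  rintro ⟨s, x⟩ hs ⟨t, y⟩ ht h
  simp only [Prod.mk.injEq] at h
  obtain ⟨rfl, h⟩ := h
  simp only [Finset.coe_product, Set.mem_prod, Finset.mem_coe, Finset.mem_erase] at hs
  rw [mul_right_cancel₀ hs.2.1 h]

/-! ### Common neighbours -/

/-- The points `z` such that `z` and `z - d` have different slopes, both in `T`. -/
def crossings (T : Finset F) (d : F × F) : Set (F × F) :=
  {z | z.1 ≠ 0 ∧ z.1 ≠ d.1 ∧
    ∃ s ∈ T, ∃ t ∈ T, s ≠ t ∧ z.2 = s * z.1 ∧ z.2 - d.2 = t * (z.1 - d.1)}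

/-- If no slope in `T` is that of `d`, each ordered pair of distinct slopes gives one crossing. -/
theorem ncard_crossings (T : Finset F) (d : F × F) (hd : ∀ t ∈ T, d.2 ≠ t * d.1) :
    (crossings T d).ncard = T.card * T.card - T.card := by
  classical
  have key : ∀ s t x : F, s ≠ t →
      (s * x - d.2 = t * (x - d.1) ↔ x = (d.2 - t * d.1) / (s - t)) := by
    intro s t x hst
    rw [eq_div_iff (sub_ne_zero.2 hst)]
    constructor <;> intro h <;> linear_combination h
  have h : crossings T d = (T.offDiag.image fun a =>
      ((d.2 - a.2 * d.1) / (a.1 - a.2), a.1 * ((d.2 - a.2 * d.1) / (a.1 - a.2))) :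
        Finset (F × F)) := by
    ext ⟨x, y⟩
    simp only [crossings, Set.mem_ofPred_eq, Finset.coe_image, Set.mem_image, Finset.mem_coe,
      Finset.mem_offDiag, Prod.exists, Prod.mk.injEq]
    constructor
    · rintro ⟨-, -, s, hs, t, ht, hst, rfl, h⟩
      rw [key s t x hst] at h
      exact ⟨s, t, ⟨hs, ht, hst⟩, h.symm, by rw [← h]⟩
    · rintro ⟨s, t, ⟨hs, ht, hst⟩, hx, hy⟩
      have hst' := sub_ne_zero.2 hst
      rw [hx] at hy
      subst hy
      have h := (key s t x hst).2 hx.symm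
      refine ⟨?_, ?_, s, hs, t, ht, hst, rfl, h⟩
      · rintro rfl
        exact hd t ht (by linear_combination -h)
      · rintro rfl
        exact hd s hs (by linear_combination -h)
  rw [h, Set.ncard_coe_finset, Finset.card_image_of_injOn, Finset.offDiag_card]
  rintro ⟨s, t⟩ hst ⟨s', t'⟩ hst' h
  simp only [Finset.coe_offDiag, Set.mem_offDiag, Finset.mem_coe] at hst hst'
  simp only [Prod.mk.injEq] at h
  obtain ⟨h1, h2⟩ := h
  obtain ⟨hs, ht, hne⟩ := hst
  obtain ⟨hs', ht', hne'⟩ := hst'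
  have e := (key s t _ hne).2 rfl
  have e' := (key s' t' _ hne').2 rfl
  rw [← h2, ← h1] at e'
  -- A crossing and its difference from `d` have nonzero first coordinates, so the slopes can be
  -- recovered by cancelling them.
  have hx : (d.2 - t * d.1) / (s - t) ≠ 0 :=
    div_ne_zero (sub_ne_zero.2 (hd t ht)) (sub_ne_zero.2 hne)
  have hx' : (d.2 - t * d.1) / (s - t) - d.1 ≠ 0 := by
    intro h0
    rw [h0] at e
    rw [sub_eq_zero] at h0
    rw [h0] at e
    exact hd s hs (by linear_combination -e)
  rw [← h1] at h2
  rw [mul_right_cancel₀ hx h2, mul_right_cancel₀ hx' (e.symm.trans e')]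

theorem ncard_common_of_notMem (T : Finset F) (d : F × F) (hd0 : d ≠ 0) (hd : d ∉ lineUnion T) :
    {z | z ∈ lineUnion T ∧ z - d ∈ lineUnion T}.ncard = T.card * T.card - T.card := by
  have hd' : ∀ t ∈ T, d.2 ≠ t * d.1 := by
    intro t ht h
    by_cases hd1 : d.1 = 0
    · exact hd0 (Prod.ext hd1 (by simpa [hd1] using h))
    · exact hd ⟨hd1, t, ht, h⟩
  rw [← ncard_crossings T d hd']
  congr 1
  ext z
  simp only [lineUnion, crossings, Set.mem_ofPred_eq, Prod.fst_sub, Prod.snd_sub, sub_ne_zero]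
  constructor
  · rintro ⟨⟨h0, s, hs, h1⟩, h2, t, ht, h3⟩
    refine ⟨h0, h2, s, hs, t, ht, ?_, h1, h3⟩
    rintro rfl
    exact hd' s hs (by linear_combination h1 - h3)
  · rintro ⟨h0, h2, s, hs, t, ht, -, h1, h3⟩
    exact ⟨⟨h0, s, hs, h1⟩, h2, t, ht, h3⟩

/-- If `d` has slope `m ∈ T`, the common points are the crossings of the other slopes together with
the points other than `0` and `d` on the line of slope `m`. -/
theorem ncard_common_of_mem [Fintype F] (T : Finset F) (d : F × F)
    (hd : d ∈ lineUnion T) :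
    {z | z ∈ lineUnion T ∧ z - d ∈ lineUnion T}.ncard =
      ((T.card - 1) * (T.card - 1) - (T.card - 1)) + (Fintype.card F - 2) := by
  classical
  obtain ⟨hd0, m, hm, hd2⟩ := hd
  have hne : ∀ t ∈ T.erase m, d.2 ≠ t * d.1 := by
    intro t ht h
    exact (Finset.mem_erase.1 ht).1 (mul_right_cancel₀ hd0 (h.symm.trans hd2))
  -- The line through `0` and `d` without these two points.
  let L : Finset (F × F) := ((Finset.univ.erase (0 : F)).erase d.1).image fun x => (x, m * x)
  have hL : L.card = Fintype.card F - 2 := by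
    rw [Finset.card_image_of_injective _ fun x y h => (Prod.mk.inj h).1,
      Finset.card_erase_of_mem (by simp [hd0]), Finset.card_erase_of_mem (Finset.mem_univ _),
      Finset.card_univ, Nat.sub_sub]
  have hmem : ∀ z : F × F, z ∈ (L : Set (F × F)) ↔ z.1 ≠ 0 ∧ z.1 ≠ d.1 ∧ z.2 = m * z.1 := by
    rintro ⟨x, y⟩
    simp only [L, Finset.coe_image, Set.mem_image, Finset.mem_coe, Finset.mem_erase,
      Finset.mem_univ, and_true, Prod.mk.injEq]
    constructor
    · rintro ⟨x, ⟨h1, h2⟩, rfl, rfl⟩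
      exact ⟨h2, h1, rfl⟩
    · rintro ⟨h2, h1, rfl⟩
      exact ⟨x, ⟨h1, h2⟩, rfl, rfl⟩
  have hunion : {z | z ∈ lineUnion T ∧ z - d ∈ lineUnion T} =
      crossings (T.erase m) d ∪ (L : Set (F × F)) := by
    ext z
    rw [Set.mem_union, hmem]
    simp only [lineUnion, crossings, Set.mem_ofPred_eq, Prod.fst_sub, Prod.snd_sub, sub_ne_zero,
      Finset.mem_erase]
    constructor
    · rintro ⟨⟨h0, s, hs, h1⟩, h2, t, ht, h3⟩
      by_cases hsm : s = m
      · exact Or.inr ⟨h0, h2, hsm ▸ h1⟩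
      refine Or.inl ⟨h0, h2, s, ⟨hsm, hs⟩, t, ⟨?_, ht⟩, ?_, h1, h3⟩
      · rintro rfl
        exact hsm (mul_right_cancel₀ h0 (by linear_combination h3 + hd2 - h1))
      · rintro rfl
        exact hsm (mul_right_cancel₀ hd0 (by linear_combination h3 + hd2 - h1))
    · rintro (⟨h0, h2, s, hs, t, ht, -, h1, h3⟩ | ⟨h0, h2, h1⟩)
      · exact ⟨⟨h0, s, hs.2, h1⟩, h2, t, ht.2, h3⟩
      · exact ⟨⟨h0, m, hm, h1⟩, h2, m, hm, by rw [h1, hd2, mul_sub]⟩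
  have hdisj : Disjoint (crossings (T.erase m) d) (L : Set (F × F)) := by
    rw [Set.disjoint_left]
    rintro z ⟨h0, -, s, hs, t, ht, -, h1, -⟩ hz
    have := ((hmem z).1 hz).2.2
    exact (Finset.mem_erase.1 hs).1 (mul_right_cancel₀ h0 (h1.symm.trans this))
  rw [hunion, Set.ncard_union_eq hdisj (Set.toFinite _) (Set.toFinite _), ncard_crossings _ _ hne,
    Set.ncard_coe_finset, hL, Finset.card_erase_of_mem hm]

theorem degree_addCayley_lineUnion (T : Finset F) (v : F × F)
    [Fintype ((SimpleGraph.addCayley (lineUnion T)).neighborSet v)] :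
    (SimpleGraph.addCayley (lineUnion T)).degree v = (lineUnion T).ncard := by
  rw [← SimpleGraph.card_neighborSet_eq_degree, ← Nat.card_eq_fintype_card, Nat.card_coe_set_eq,
    ← Set.ncard_image_of_injective (lineUnion T) (add_right_injective v)]
  congr 1
  ext u
  rw [SimpleGraph.mem_neighborSet, addCayley_lineUnion_adj]
  constructor
  · intro h
    exact ⟨u - v, h, by simp⟩
  · rintro ⟨z, h, rfl⟩
    simpa using h

theorem card_commonNeighbors_addCayley_lineUnion (T : Finset F) (v w : F × F)
    [Fintype ((SimpleGraph.addCayley (lineUnion T)).commonNeighbors v w)] :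
    Fintype.card ((SimpleGraph.addCayley (lineUnion T)).commonNeighbors v w) =
      {z | z ∈ lineUnion T ∧ z - (w - v) ∈ lineUnion T}.ncard := by
  rw [← Nat.card_eq_fintype_card, Nat.card_coe_set_eq,
    ← Set.ncard_image_of_injective {z | z ∈ lineUnion T ∧ z - (w - v) ∈ lineUnion T}
      (add_right_injective v)]
  congr 1
  ext u
  rw [SimpleGraph.mem_commonNeighbors, addCayley_lineUnion_adj, addCayley_lineUnion_adj]
  constructor
  · rintro ⟨h1, h2⟩
    exact ⟨u - v, ⟨h1, by simpa using h2⟩, by simp⟩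
  · rintro ⟨z, ⟨h1, h2⟩, rfl⟩
    exact ⟨by simpa using h1, by simpa [sub_sub_eq_add_sub, add_comm] using h2⟩

/-! ### Strong regularity -/

theorem isSRGWith_addCayley_lineUnion [Fintype F] (T : Finset F)
    [DecidableRel (SimpleGraph.addCayley (lineUnion T)).Adj]
    (v k ℓ μ : ℕ) (hv : Fintype.card F ^ 2 = v)
    (hk : T.card * (Fintype.card F - 1) = k)
    (hℓ : ((T.card - 1) * (T.card - 1) - (T.card - 1)) + (Fintype.card F - 2) = ℓ)
    (hμ : T.card * T.card - T.card = μ) :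
    (SimpleGraph.addCayley (lineUnion T)).IsSRGWith v k ℓ μ where
  card := by rw [Fintype.card_prod, ← sq, hv]
  regular v := (degree_addCayley_lineUnion T v).trans ((ncard_lineUnion T).trans hk)
  of_adj v w h := by
    rw [card_commonNeighbors_addCayley_lineUnion, ncard_common_of_mem, hℓ]
    rwa [← addCayley_lineUnion_adj]
  of_not_adj v w hne h := by
    rw [card_commonNeighbors_addCayley_lineUnion, ncard_common_of_notMem, hμ]
    · exact sub_ne_zero.2 hne.symm
    · rwa [← addCayley_lineUnion_adj]

/-- At least one line is needed for the graph to have edges; it is never complete because the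
vertical line is not used. -/
theorem isStronglyRegularCayley_lines [Fintype F] (T : Finset F) (hT : T.Nonempty)
    (v k ℓ μ : ℕ) (hv : Fintype.card F ^ 2 = v)
    (hk : T.card * (Fintype.card F - 1) = k)
    (hℓ : ((T.card - 1) * (T.card - 1) - (T.card - 1)) + (Fintype.card F - 2) = ℓ)
    (hμ : T.card * T.card - T.card = μ) :
    IsStronglyRegularCayley (lineUnion T) v k ℓ μ where
  zero_notMem := zero_notMem_lineUnion T
  neg_mem_iff := neg_mem_lineUnion_iff T
  ne_bot := by
    obtain ⟨t, ht⟩ := hT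
    have h : (SimpleGraph.addCayley (lineUnion T)).Adj 0 (1, t) := by
      rw [addCayley_lineUnion_adj]
      exact ⟨by simp, t, ht, by simp⟩
    intro h0
    rw [h0] at h
    exact h
  ne_top := by
    intro h0
    have h : (SimpleGraph.addCayley (lineUnion T)).Adj 0 (0, 1) := by
      rw [h0]
      simp [Prod.ext_iff]
    rw [addCayley_lineUnion_adj] at h
    exact h.1 (by simp)
  isSRGWith := by
    classical
    convert isSRGWith_addCayley_lineUnion T v k ℓ μ hv hk hℓ hμ

/-- For each `0 < r ≤ n`, the affine plane over the field with `n` elements carries a strongly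
regular Cayley graph of Latin square type. -/
theorem exists_isStronglyRegularCayley_latinSquare [Fintype F] (r : ℕ) (hr : 0 < r)
    (hrn : r ≤ Fintype.card F) :
    ∃ k ℓ μ : ℕ, (k : ℤ) = r * ((Fintype.card F : ℤ) - 1) ∧
      (ℓ : ℤ) = (Fintype.card F : ℤ) + (r : ℤ) ^ 2 - 3 * r ∧ (μ : ℤ) = (r : ℤ) ^ 2 - r ∧
      ∃ D : Set (F × F), IsStronglyRegularCayley D (Fintype.card F ^ 2) k ℓ μ := by
  obtain ⟨T, -, hT⟩ := Finset.exists_subset_card_eq (s := (Finset.univ : Finset F)) (n := r)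
    (by rwa [Finset.card_univ])
  have hn : 2 ≤ Fintype.card F := Fintype.one_lt_card
  refine ⟨_, _, _, ?_, ?_, ?_, lineUnion T, isStronglyRegularCayley_lines T
    (Finset.card_pos.1 (hT ▸ hr)) _ _ _ _ rfl rfl rfl rfl⟩
  · rw [hT]
    push_cast [Nat.cast_sub (show 1 ≤ Fintype.card F by omega)]
    ring
  · rw [hT]
    push_cast [Nat.cast_sub (Nat.le_mul_self (r - 1)), Nat.cast_sub hn,
      Nat.cast_sub (show 1 ≤ r from hr)]
    ring
  · rw [hT]
    push_cast [Nat.cast_sub (Nat.le_mul_self r)]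
    ring

end LineUnion

/-! ### Integrality and range of `r` -/

theorem mainTheorem9
    (N p q m j s : ℕ) (hN : Odd N) (hp : p.Prime) (hs : 2 ≤ s)
    (hj : IsLeast {i : ℕ | 0 < i ∧ N ∣ p ^ i + 1} j)
    (hq : q ^ m = p ^ (2 * j * s))
    (hcop : Nat.gcd N ((q ^ m - 1) / N) = 1)
    (F : Type*) [Field F] [Fintype F] (hF : Fintype.card F = q ^ m) :
    (p ≠ 2 →
      ∃ r k ℓ μ : ℕ,
        (r : ℚ) = ((q : ℚ) ^ m - 1) / (2 * N) ∧
        (k : ℤ) = r * ((q : ℤ) ^ m - 1) ∧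
        (ℓ : ℤ) = (q : ℤ) ^ m + (r : ℤ) ^ 2 - 3 * r ∧
        (μ : ℤ) = (r : ℤ) ^ 2 - r ∧
        ∃ D : Set (F × F), IsStronglyRegularCayley D (q ^ (2 * m)) k ℓ μ) ∧
    (2 ≤ N →
      ∃ r k ℓ μ : ℕ,
        (r : ℚ) = ((N : ℚ) - 1) * ((q : ℚ) ^ m - 1) / (2 * N) ∧
        (k : ℤ) = r * ((q : ℤ) ^ m - 1) ∧
        (ℓ : ℤ) = (q : ℤ) ^ m + (r : ℤ) ^ 2 - 3 * r ∧
        (μ : ℤ) = (r : ℤ) ^ 2 - r ∧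
        ∃ D : Set (F × F), IsStronglyRegularCayley D (q ^ (2 * m)) k ℓ μ) := by
  have hn2 : 2 ≤ q ^ m := hF ▸ Fintype.one_lt_card
  have hN0 : 0 < N := hN.pos
  have hNq : (N : ℚ) ≠ 0 := by exact_mod_cast hN0.ne'
  have hdvd : N ∣ q ^ m - 1 := by
    rw [hq, show 2 * j * s = j * 2 * s by ring]
    refine (hj.1.2.trans ?_).trans (Nat.pow_sub_one_dvd_pow_sub_one p (Dvd.intro s rfl))
    rw [pow_mul, ← one_pow 2, Nat.sq_sub_sq, one_pow]
    exact Dvd.intro _ rfl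
  have hcast : ((q ^ m - 1 : ℕ) : ℚ) = (q : ℚ) ^ m - 1 := by
    push_cast [Nat.cast_sub (show 1 ≤ q ^ m by omega)]
    ring
  -- In both parts only the value of `r` and the bounds `0 < r ≤ qᵐ` matter.
  have main : ∀ r : ℕ, 0 < r → r ≤ q ^ m → ∃ k ℓ μ : ℕ,
      (k : ℤ) = r * ((q : ℤ) ^ m - 1) ∧ (ℓ : ℤ) = (q : ℤ) ^ m + (r : ℤ) ^ 2 - 3 * r ∧
      (μ : ℤ) = (r : ℤ) ^ 2 - r ∧
      ∃ D : Set (F × F), IsStronglyRegularCayley D (q ^ (2 * m)) k ℓ μ := by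
    intro r hr hrn
    have h := exists_isStronglyRegularCayley_latinSquare (F := F) r hr (hF ▸ hrn)
    rw [hF, ← pow_mul, mul_comm m 2] at h
    simpa only [Nat.cast_pow] using h
  constructor
  · intro hp2
    have h2 : 2 ∣ q ^ m - 1 := by
      rw [hq]
      exact (Nat.Odd.sub_odd (hp.odd_of_ne_two hp2).pow odd_one).two_dvd
    obtain ⟨r, hr⟩ : 2 * N ∣ q ^ m - 1 :=
      (Nat.coprime_two_left.2 hN).mul_dvd_of_dvd_of_dvd h2 hdvd
    have hr0 : 0 < r := Nat.pos_of_ne_zero (by rintro rfl; omega)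
    have hle : r ≤ 2 * N * r := Nat.le_mul_of_pos_left r (by omega)
    refine ⟨r, ?_⟩
    obtain ⟨k, ℓ, μ, h⟩ := main r hr0 (by omega)
    refine ⟨k, ℓ, μ, ?_, h⟩
    rw [← hcast, hr]
    push_cast
    field_simp
  · intro hN2
    obtain ⟨c, hc⟩ := hdvd
    obtain ⟨a, ha⟩ := hN
    have hr0 : 0 < a * c := Nat.mul_pos (by omega) (Nat.pos_of_ne_zero (by rintro rfl; omega))
    have hle : a * c ≤ N * c := Nat.mul_le_mul_right c (by omega)
    refine ⟨a * c, ?_⟩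
    obtain ⟨k, ℓ, μ, h⟩ := main (a * c) hr0 (by omega)
    refine ⟨k, ℓ, μ, ?_, h⟩
    rw [← hcast, hc, show (N : ℚ) - 1 = 2 * a by rw [ha]; push_cast; ring]
    push_cast
    field_simp
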